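/- **Setting.** An operational probabilistic theory (OPT) has systems $A,B,\dots$ (with trivial system $I$), composite systems $A\boxtimes B$, and events $A\to B$ that compose sequentially and in parallel (a monoidal category). Certain finite families of events $A\to B$ are *tests*; every event belongs to a test, identities (and structural isomorphisms) are one-outcome tests, tests are closed under relabelling of outcomes, sequential and parallel composition and, up to operational equivalence, under grouping (summing) of outcomes. Each event $s:I\to I$ has a probability $p(s)\ge 0$, the probabilities of a test $I\to I$ sum to $1$, and $p$ is multiplicative under composition. For $\rho:I\to A$ and $a:A\to I$ write $(a|\rho)$ for the probability of $a\circ\rho$. States (effects) are events $I\to A$ ($A\to I$), two states of $A$ being identified when $(a|\rho)=(a|\sigma)$ for all $a$; $\mathsf{St}_{\mathbb R}(A)$ is the real span of the states, assumed finite-dimensional, and $D_A$ is its dimension. Two events $A\to B$ are identified as transformations when they give the same probabilities in all closed circuits $I\to A\boxtimes C\to B\boxtimes C\to I$. An event is *deterministic* if it forms a one-outcome test. A *refinement* of a state $\rho$ is a subfamily $\{\rho_i\}_{i\in Y}$ of a preparation test with $\rho=\sum_{i\in Y}\rho_i$; $\rho$ is *pure* if in every refinement each $\rho_i$ equals $\lambda_i\rho$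 with $\lambda_i\in[0,1]$. A *dilation* of $\rho$ is a state $\Omega$ of some $A\boxtimes C$ with $(I_A\boxtimes e)\Omega=\rho$ for a deterministic effect $e$ of $C$. For $\delta\in \mathsf{St}_{\mathbb R}(A)$ let $\|\delta\|_{\rm op}=\sup_a (2a-e|\delta)$, the supremum being over all effects $a$ in observation tests of $A$, with $e$ the sum of the test containing $a$. The OPT is *strongly causal* if for every test $\{\mathscr A_i\}_{i\in X}$ from $A$ to $B$ and tests $\{\mathscr B^i_j\}_{j\in Y}$ from $B$ to $C$ $(i\in X)$ the family $\{\mathscr B^i_j\circ\mathscr A_i\}_{(i,j)}$ is a test. It has *regular scaling* if for every $A$ there is $k_A>0$ with $D_{A^{\boxtimes N}}\le k_A D_A^N$ for all $N$. Say that $A$ *can be encoded in* $A'$ if there are deterministic $\mathscr C:A\to A'$ and $\mathscr F:A'\to A$ with $\mathscr F\circ\mathscr C=\mathscr I_A$ as transformations. An *obit* is a system $B$ such that every system can be encoded in $B^{\boxtimes k}$ for some finite $k$. The OPT is *digitalizable* if an obit exists and any two obits $B_1,B_2$ are asymptotically equivalent: if $M_2(n)$ is the least $m$ such that $B_1^{\boxtimes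 n}$ can be encoded in $B_2^{\boxtimes m}$, and $M_1(n)$ is defined with the roles exchanged, then $M_2(n)/n\to\kappa$ and $M_1(n)/n\to\kappa^{-1}$ for some $\kappa>0$. Fix an obit $B$ and a deterministic state $\rho$ of a system $A$. For $N,M\in\mathbb N$ and $\varepsilon>0$ let $E_{N,M,\varepsilon}(\rho)$ be the set of pairs of deterministic events $\mathscr E:A^{\boxtimes N}\to B^{\boxtimes M}$, $\mathscr D:B^{\boxtimes M}\to A^{\boxtimes N}$ with $$\sup\ \sum_{i}\big\|(\mathscr D\mathscr E\boxtimes \mathscr I_C)\Psi_i-\Psi_i\big\|_{\rm op}<\varepsilon,$$ the supremum being over all systems $C$ and all refinements $\{\Psi_i\}$ of dilations of $\rho^{\boxtimes N}$ in $A^{\boxtimes N}\boxtimes C$. The *information content* of $\rho$ is $$I(\rho)=\lim_{\varepsilon\to0^+}\ \limsup_{N\to\infty}\ \frac{\min\{M: E_{N,M,\varepsilon}(\rho)\ne\emptyset\}}{N}.$$ **Proposition.** In a strongly causal, digitalizable OPT with regular scaling, let $B$ be any obit and $\rho$ a deterministic state of a system $A$. If the information content of $\rho$ (measured in units of $B$)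 is $I(\rho)=0$, then $\rho$ is a pure state. -/

import Mathlib

open CategoryTheory MonoidalCategory Filter Topology
open scoped ENNReal

universe v u

/-- An operational probabilistic theory whose systems are the objects of a monoidal category `S` and
whose events are its morphisms: composition is sequential composition, the tensor product is parallel
composition, and the tensor unit is the trivial system. (For a strict category the associators and
unitors are identities; in general they are deterministic events.)  `IsTest t` says that the finite
family of events `t` is a test, and `prob s` is the probability of the closed circuit `s`. -/
structure OPT (S : Type u) [Category.{v} S] [MonoidalCategory S] where
  IsTest : ∀ {X : Type} [Finite X] {A B : S}, (X → (A ⟶ B)) → Prop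
  prob : (𝟙_ S ⟶ 𝟙_ S) → ℝ
  /-- Every event belongs to some test. -/
  exists_test : ∀ {A B : S} (f : A ⟶ B), ∃ (X : Type) (_ : Finite X) (t : X → (A ⟶ B)) (x : X),
    IsTest t ∧ t x = f
  /-- The names of the outcomes are immaterial. -/
  relabel : ∀ {X Y : Type} [Finite X] [Finite Y] {A B : S} (t : X → (A ⟶ B)) (σ : Y ≃ X),
    IsTest t → IsTest (fun y => t (σ y))
  id_test : ∀ A : S, IsTest (fun _ : Unit => 𝟙 A)
  associator_hom_test : ∀ A B C : S, IsTest (fun _ : Unit => (α_ A B C).hom)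
  associator_inv_test : ∀ A B C : S, IsTest (fun _ : Unit => (α_ A B C).inv)
  leftUnitor_hom_test : ∀ A : S, IsTest (fun _ : Unit => (λ_ A).hom)
  leftUnitor_inv_test : ∀ A : S, IsTest (fun _ : Unit => (λ_ A).inv)
  rightUnitor_hom_test : ∀ A : S, IsTest (fun _ : Unit => (ρ_ A).hom)
  rightUnitor_inv_test : ∀ A : S, IsTest (fun _ : Unit => (ρ_ A).inv)
  /-- Sequential composition of tests. -/
  seq_test : ∀ {X Y : Type} [Finite X] [Finite Y] {A B C : S} (f : X → (A ⟶ B)) (g : Y → (B ⟶ C)),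
    IsTest f → IsTest g → IsTest (fun p : X × Y => f p.1 ≫ g p.2)
  /-- Parallel composition of tests. -/
  par_test : ∀ {X Y : Type} [Finite X] [Finite Y] {A B C D : S}
    (f : X → (A ⟶ B)) (g : Y → (C ⟶ D)),
    IsTest f → IsTest g → IsTest (fun p : X × Y => f p.1 ⊗ₘ g p.2)
  prob_nonneg : ∀ s, 0 ≤ prob s
  /-- A test from the trivial system to itself is a probability distribution. -/
  prob_sum : ∀ {X : Type} [Fintype X] (t : X → (𝟙_ S ⟶ 𝟙_ S)), IsTest t → ∑ x, prob (t x) = 1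
  /-- Compound tests from the trivial system to itself are independent. -/
  prob_comp : ∀ s t : 𝟙_ S ⟶ 𝟙_ S, prob (s ≫ t) = prob s * prob t
  /-- Grouping the outcomes of a test gives a test; the events of the new test are operationally
  (in every circuit with an ancilla) the sums of the grouped events. -/
  coarse_grain : ∀ {X Y : Type} [Fintype X] [DecidableEq Y] [Finite Y] {A B : S}
    (t : X → (A ⟶ B)) (π : X → Y), Function.Surjective π → IsTest t →
    ∃ s : Y → (A ⟶ B), IsTest s ∧ ∀ (y : Y) (C : S) (Ψ : 𝟙_ S ⟶ A ⊗ C) (a : B ⊗ C ⟶ 𝟙_ S),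
      prob (Ψ ≫ (s y ▷ C) ≫ a) = ∑ x with π x = y, prob (Ψ ≫ (t x ▷ C) ≫ a)

namespace OPT

noncomputable section

variable {S : Type u} [Category.{v} S] [MonoidalCategory S] (O : OPT S)

/-- An event is deterministic if it forms a singleton test. -/
def IsDet {A B : S} (f : A ⟶ B) : Prop := O.IsTest (fun _ : Unit => f)

/-- Operational equivalence of events: two equivalent events are the same transformation. -/
def OpEquiv {A B : S} (f g : A ⟶ B) : Prop :=
  ∀ (C : S) (Ψ : 𝟙_ S ⟶ A ⊗ C) (a : B ⊗ C ⟶ 𝟙_ S),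
    O.prob (Ψ ≫ (f ▷ C) ≫ a) = O.prob (Ψ ≫ (g ▷ C) ≫ a)

/-- The pairing `(a|ρ)` of a preparation event with all observation events. -/
def pairing {A : S} (ρ : 𝟙_ S ⟶ A) : (A ⟶ 𝟙_ S) → ℝ := fun a => O.prob (ρ ≫ a)

/-- The real vector space `St_ℝ(A)` spanned by the states of `A`. -/
def StR (A : S) : Submodule ℝ ((A ⟶ 𝟙_ S) → ℝ) := Submodule.span ℝ (Set.range (O.pairing (A := A)))

/-- The state (equivalence class of a preparation event) as an element of `St_ℝ(A)`. -/
def state {A : S} (ρ : 𝟙_ S ⟶ A) : O.StR A :=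
  ⟨O.pairing ρ, Submodule.subset_span (Set.mem_range_self ρ)⟩

/-- The size `D_A` of a system. -/
def size (A : S) : ℕ := Module.finrank ℝ (O.StR A)

/-- All the spaces `St_ℝ(A)` are finite-dimensional. -/
def IsFiniteDim : Prop := ∀ A : S, FiniteDimensional ℝ (O.StR A)

/-- Strong causality: the choice of a test may depend on the outcome of a previous test. -/
def StronglyCausal : Prop :=
  ∀ {X Y : Type} [Finite X] [Finite Y] {A B C : S} (f : X → (A ⟶ B)) (g : X → Y → (B ⟶ C)),
    O.IsTest f → (∀ i, O.IsTest (g i)) → O.IsTest (fun p : X × Y => f p.1 ≫ g p.1 p.2)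

/-- The family `(t i)`, `i ∈ Y`, of events of the preparation test `t` is a refinement of `ρ`. -/
def IsRefinement {A : S} (ρ : 𝟙_ S ⟶ A) {X : Type} [Fintype X] (t : X → (𝟙_ S ⟶ A))
    (Y : Finset X) : Prop :=
  O.IsTest t ∧ O.state ρ = ∑ i ∈ Y, O.state (t i)

/-- A state is pure if it has only trivial refinements. -/
def IsPure {A : S} (ρ : 𝟙_ S ⟶ A) : Prop :=
  ∀ (X : Type) [Fintype X] (t : X → (𝟙_ S ⟶ A)) (Y : Finset X), O.IsRefinement ρ t Y →
    ∀ i ∈ Y, ∃ c : ℝ, 0 ≤ c ∧ c ≤ 1 ∧ O.state (t i) = c • O.state ρ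

/-- `Ψ` is a dilation of `ρ`: some deterministic effect of the second system maps `Ψ` to `ρ`. -/
def IsDilation {A B : S} (ρ : 𝟙_ S ⟶ A) (Ψ : 𝟙_ S ⟶ A ⊗ B) : Prop :=
  ∃ e : B ⟶ 𝟙_ S, O.IsDet e ∧ O.state ρ = O.state (Ψ ≫ (A ◁ e) ≫ (ρ_ A).hom)

/-- The operational norm `sup_a (2a - e | δ)`, where `e` is the coarse-graining of the observation
test that contains `a`. (The set is bounded above for every `δ` in `St_ℝ(A)`.) -/
def opNorm {A : S} (δ : O.StR A) : ℝ :=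
  sSup {r : ℝ | ∃ (X : Type) (_ : Fintype X) (a : X → (A ⟶ 𝟙_ S)) (j : X), O.IsTest a ∧
    r = 2 * δ.1 (a j) - ∑ k, δ.1 (a k)}

end

/-- The parallel power `A^{⊠ N}` of a system. -/
def pow {S : Type u} [Category.{v} S] [MonoidalCategory S] (A : S) : ℕ → S
  | 0 => 𝟙_ S
  | N + 1 => pow A N ⊗ A

/-- The parallel power `ρ^{⊠ N}` of a preparation event. -/
def statePow {S : Type u} [Category.{v} S] [MonoidalCategory S] {A : S} (ρ : 𝟙_ S ⟶ A) :
    (N : ℕ) → (𝟙_ S ⟶ pow A N)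
  | 0 => 𝟙 (𝟙_ S)
  | N + 1 => (λ_ (𝟙_ S)).inv ≫ (statePow ρ N ⊗ₘ ρ)

noncomputable section

variable {S : Type u} [Category.{v} S] [MonoidalCategory S] (O : OPT S)

/-- `A` can be perfectly encoded in `B` by deterministic transformations. -/
def Encodes (A B : S) : Prop :=
  ∃ (E : A ⟶ B) (D : B ⟶ A), O.IsDet E ∧ O.IsDet D ∧ O.OpEquiv (E ≫ D) (𝟙 A)

/-- Asymptotic equivalence: with `m₂ k₁` the least number of copies of `A₂` in which `k₁` copies of
`A₁` can be encoded, and `m₁` likewise, `m₂ k₁ / k₁ → k` and `m₁ h₂ / h₂ → k⁻¹`. -/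
def AsympEquiv (A₁ A₂ : S) : Prop :=
  ∃ (m₂ m₁ : ℕ → ℕ) (k : ℝ), 0 < k ∧
    (∀ k₁, IsLeast {k₂ : ℕ | O.Encodes (pow A₁ k₁) (pow A₂ k₂)} (m₂ k₁)) ∧
    (∀ h₂, IsLeast {h₁ : ℕ | O.Encodes (pow A₂ h₂) (pow A₁ h₁)} (m₁ h₂)) ∧
    Tendsto (fun k₁ : ℕ => (m₂ k₁ : ℝ) / k₁) atTop (𝓝 k) ∧
    Tendsto (fun h₂ : ℕ => (m₁ h₂ : ℝ) / h₂) atTop (𝓝 k⁻¹)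

/-- An obit: every system can be perfectly encoded in finitely many copies of it. -/
def IsObit (B : S) : Prop := ∀ A : S, ∃ k : ℕ, O.Encodes A (pow B k)

/-- Digitalizability: obits exist, and any two are asymptotically equivalent. -/
def Digitalizable : Prop :=
  (∃ B : S, O.IsObit B) ∧ ∀ B₁ B₂ : S, O.IsObit B₁ → O.IsObit B₂ → O.AsympEquiv B₁ B₂

/-- Regular scaling: the size of `N` copies of a system grows at most exponentially in `N`. -/
def RegularScaling : Prop :=
  ∀ A : S, ∃ k : ℝ, 0 < k ∧ ∀ N : ℕ, (O.size (pow A N) : ℝ) ≤ k * (O.size A : ℝ) ^ N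

/-- The figure of merit of a transformation `T` of `A`, for a state `ρ` of `A`: the supremum, over
all systems `C` and all refinements `(Ψ_i)` of a dilation of `ρ` in `A ⊠ C`, of
`∑ i, ‖(T ⊠ I_C) Ψ_i - Ψ_i‖`. -/
def disturbance {A : S} (ρ : 𝟙_ S ⟶ A) (T : A ⟶ A) : EReal :=
  sSup {r : EReal | ∃ (C : S) (Ω : 𝟙_ S ⟶ A ⊗ C) (X : Type) (_ : Fintype X)
    (Ψ : X → (𝟙_ S ⟶ A ⊗ C)) (Y : Finset X), O.IsDilation ρ Ω ∧ O.IsRefinement Ω Ψ Y ∧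
    r = ((∑ i ∈ Y, O.opNorm (O.state (Ψ i ≫ (T ▷ C)) - O.state (Ψ i)) : ℝ) : EReal)}

/-- The set `E_{N,M,ε}(ρ)` of `(ε, N)`-reliable compression schemes with `M` copies of `B`. -/
def reliableSchemes (B : S) {A : S} (ρ : 𝟙_ S ⟶ A) (N M : ℕ) (ε : ℝ) :
    Set ((pow A N ⟶ pow B M) × (pow B M ⟶ pow A N)) :=
  {c | O.IsDet c.1 ∧ O.IsDet c.2 ∧ O.disturbance (statePow ρ N) (c.1 ≫ c.2) < (ε : EReal)}

/-- The smallest achievable compression ratio `R_{N,ε}(ρ)` (`∞` if there is no reliable scheme). -/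
def ratio (B : S) {A : S} (ρ : 𝟙_ S ⟶ A) (N : ℕ) (ε : ℝ) : ℝ≥0∞ :=
  sInf {r : ℝ≥0∞ | ∃ M : ℕ, (O.reliableSchemes B ρ N M ε).Nonempty ∧ r = (M : ℝ≥0∞) / (N : ℝ≥0∞)}

/-- The information content `I(ρ)` in units of the obit `B`. -/
def infoContent (B : S) {A : S} (ρ : 𝟙_ S ⟶ A) : ℝ≥0∞ :=
  limUnder (𝓝[>] (0 : ℝ)) fun ε => limsup (fun N : ℕ => O.ratio B ρ N ε) atTop

/-- The limit in the definition of the information content always exists. -/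
theorem tendsto_infoContent (B : S) {A : S} (ρ : 𝟙_ S ⟶ A) :
    Tendsto (fun ε : ℝ => limsup (fun N : ℕ => O.ratio B ρ N ε) atTop) (𝓝[>] 0)
      (𝓝 (O.infoContent B ρ)) := by
  have hanti : Antitone (fun ε : ℝ => limsup (fun N : ℕ => O.ratio B ρ N ε) atTop) := by
    intro ε ε' h
    refine limsup_le_limsup (Eventually.of_forall fun N => ?_)
    refine sInf_le_sInf ?_
    rintro r ⟨M, ⟨c, h1, h2, h3⟩, rfl⟩
    exact ⟨M, ⟨c, h1, h2, h3.trans_le (by exact_mod_cast h)⟩, rfl⟩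
  exact tendsto_nhds_limUnder ⟨_, hanti.tendsto_nhdsGT 0⟩

end

end OPT

/-! Purity amounts to independence. A refinement of a deterministic `ρ` exhausts its preparation
test `t`, and if for every observation test `a` the joint distribution `p x j` of preparation and
observation is the product of its marginals, then each `t x` is its probability times `ρ`.

Suppose instead that some `p` is correlated. For `N` copies, Chernoff bounds give sets `G y` of
preparation sequences that contain the true one with probability at least `1 - exp (-cN)`, although
each has prior probability at most `exp (-cN)` (`exists_correlation_sets`). After passage through a
system of size `D`, such a guess succeeds with probability at most `D * exp (-cN)`
(`sum_sum_prob_le_size_mul`). Strong causality keeps the priors unchanged by the compression, and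
disturbance below 1 costs at most 1/2 of the success probability. Zero information content and
regular scaling allow `D ≤ k * exp (cN/2)`, so `1 - exp (-cN) ≤ k * exp (-cN/2) + 1/2`, which is
false for large `N`. -/

/-- A finite family of vectors has a subfamily, at most as large as the dimension, of which every
member is a linear combination with coefficients in `[-1, 1]`. -/
theorem exists_subfamily_abs_coeff_le_one {V X : Type*} [AddCommGroup V] [Module ℝ V]
    [FiniteDimensional ℝ V] [Finite X] (w : X → V) :
    ∃ (r : ℕ) (s : Fin r → X), r ≤ Module.finrank ℝ V ∧
      ∀ x, ∃ c : Fin r → ℝ, (∀ i, |c i| ≤ 1) ∧ w x = ∑ i, c i • w (s i) := by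
  set U := Submodule.span ℝ (Set.range w) with hU
  let w' : X → U := fun x => ⟨w x, Submodule.subset_span (Set.mem_range_self x)⟩
  let b : Module.Basis (Fin (Module.finrank ℝ U)) ℝ U := Module.finBasis ℝ U
  obtain ⟨f, hf, -, hli⟩ := Submodule.exists_fun_fin_finrank_span_eq ℝ (Set.range w)
  choose s₀ hs₀ using hf
  have hli' : LinearIndependent ℝ (w' ∘ s₀) := by
    refine LinearIndependent.of_comp U.subtype ?_
    have : (U.subtype ∘ (w' ∘ s₀)) = f := by
      funext i
      exact hs₀ i
    rwa [this]
  have hdet₀ : b.det (w' ∘ s₀) ≠ 0 :=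
    (b.is_basis_iff_det.1 ⟨hli', hli'.span_eq_top_of_card_eq_finrank' (Fintype.card_fin _)⟩).ne_zero
  have : Nonempty (Fin (Module.finrank ℝ U) → X) := ⟨s₀⟩
  -- Choose the subfamily of largest absolute determinant. By Cramer's rule each coefficient is a
  -- quotient of two such determinants, with this maximum as denominator.
  obtain ⟨s, hs⟩ := Finite.exists_max
    (fun s : Fin (Module.finrank ℝ U) → X => |b.det (w' ∘ s)|)
  have hpos : 0 < |b.det (w' ∘ s)| := (abs_pos.2 hdet₀).trans_le (hs s₀)
  obtain ⟨hsli, hssp⟩ := b.is_basis_iff_det.2 (IsUnit.mk0 _ (abs_pos.1 hpos))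
  refine ⟨_, s, Submodule.finrank_le U, fun x => ?_⟩
  let e := Module.Basis.mk hsli hssp.ge
  refine ⟨fun i => e.coord i (w' x), fun i => ?_, ?_⟩
  · have h := LinearMap.congr_fun (b.det_smul_mk_coord_eq_det_update hsli hssp.ge i) (w' x)
    have h' : b.det (w' ∘ s) * e.coord i (w' x) = b.det (w' ∘ Function.update s i x) := by
      rw [Function.comp_update]
      simpa [e] using h
    have h2 := hs (Function.update s i x)
    simp only [← h', abs_mul] at h2
    exact le_of_mul_le_mul_left (by simpa using h2) hpos
  · have h := congrArg Subtype.val (e.sum_repr (w' x))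
    simpa [e, w'] using h.symm

/-! ### Large deviations of finite random variables -/

/-- Second-order bound on the moment generating function: `exp u ≤ 1 + u + u ^ 2` for `|u| ≤ 1`,
averaged, then `1 + v ≤ exp v`. -/
theorem sum_mul_exp_le {ι : Type*} [Fintype ι] (w ψ : ι → ℝ) (hw : ∀ i, 0 ≤ w i)
    (hw1 : ∑ i, w i = 1) (hψ : ∀ i, |ψ i| ≤ 1) {s : ℝ} (hs : |s| ≤ 1) :
    ∑ i, w i * Real.exp (s * ψ i) ≤ Real.exp (s * ∑ i, w i * ψ i + s ^ 2) := by
  have h1 : ∀ i, w i * Real.exp (s * ψ i) ≤ w i * (1 + s * ψ i + s ^ 2) := by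
    intro i
    refine mul_le_mul_of_nonneg_left ?_ (hw i)
    have h := (abs_le.1 (Real.abs_exp_sub_one_sub_id_le (x := s * ψ i)
      (by rw [abs_mul]; exact mul_le_one₀ hs (abs_nonneg _) (hψ i)))).2
    have h2 : ψ i ^ 2 ≤ 1 := (sq_le_one_iff_abs_le_one _).2 (hψ i)
    nlinarith [sq_nonneg s]
  have h2 : ∑ i, w i * (1 + s * ψ i + s ^ 2) = s * ∑ i, w i * ψ i + s ^ 2 + 1 := by
    have : ∀ i, w i * (1 + s * ψ i + s ^ 2) = w i * (1 + s ^ 2) + s * (w i * ψ i) := fun i => by ring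
    simp only [this, Finset.sum_add_distrib, ← Finset.sum_mul, ← Finset.mul_sum, hw1]
    ring
  exact (Finset.sum_le_sum fun i _ => h1 i).trans (h2.le.trans (Real.add_one_le_exp _))

/-- Chernoff's bound for independent (not identically distributed) summands. -/
theorem sum_filter_prod_le_exp {ι : Type*} [Fintype ι] {N : ℕ} (w ψ : Fin N → ι → ℝ)
    (hw : ∀ n i, 0 ≤ w n i) (hw1 : ∀ n, ∑ i, w n i = 1) (hψ : ∀ n i, |ψ n i| ≤ 1) {s m a : ℝ}
    (hs0 : 0 ≤ s) (hs : s ≤ 1) (hm : ∀ n, ∑ i, w n i * ψ n i = m) (G : Finset (Fin N → ι))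
    (hG : ∀ x ∈ G, N * a ≤ ∑ n, ψ n (x n)) :
    ∑ x ∈ G, ∏ n, w n (x n) ≤ Real.exp (N * (s * m + s ^ 2 - s * a)) := by
  -- Markov's inequality: on `G` the inserted exponential factor is at least 1. The sum may then run
  -- over all sequences, where it factorizes.
  have h1 : ∀ x ∈ G, ∏ n, w n (x n) ≤
      Real.exp (-(N * (s * a))) * ∏ n, (w n (x n) * Real.exp (s * ψ n (x n))) := by
    intro x hx
    rw [Finset.prod_mul_distrib, ← Real.exp_sum, mul_left_comm, ← Real.exp_add]
    refine le_mul_of_one_le_right (Finset.prod_nonneg fun n _ => hw n _) (Real.one_le_exp ?_)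
    rw [← Finset.mul_sum]
    nlinarith [hG x hx]
  have h2 : ∑ x : Fin N → ι, ∏ n, (w n (x n) * Real.exp (s * ψ n (x n))) ≤
      Real.exp (N * (s * m + s ^ 2)) := by
    classical
    rw [← Fintype.piFinset_univ,
      ← Finset.prod_univ_sum _ fun n i => w n i * Real.exp (s * ψ n i)]
    calc _ ≤ ∏ _n : Fin N, Real.exp (s * m + s ^ 2) := by
          refine Finset.prod_le_prod
            (fun n _ => Finset.sum_nonneg fun i _ => mul_nonneg (hw n i) (Real.exp_pos _).le)
            fun n _ => ?_
          rw [← hm n]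
          exact sum_mul_exp_le _ _ (hw n) (hw1 n) (hψ n) (by rwa [abs_of_nonneg hs0])
      _ = _ := by simp [← Real.exp_nat_mul]
  calc ∑ x ∈ G, ∏ n, w n (x n)
      ≤ ∑ x ∈ G, Real.exp (-(N * (s * a))) * ∏ n, (w n (x n) * Real.exp (s * ψ n (x n))) :=
        Finset.sum_le_sum h1
    _ ≤ ∑ x : Fin N → ι, Real.exp (-(N * (s * a))) *
          ∏ n, (w n (x n) * Real.exp (s * ψ n (x n))) :=
        Finset.sum_le_sum_of_subset_of_nonneg (Finset.subset_univ _) fun x _ _ =>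
          mul_nonneg (Real.exp_pos _).le (Finset.prod_nonneg fun n _ =>
            mul_nonneg (hw n _) (Real.exp_pos _).le)
    _ ≤ Real.exp (-(N * (s * a))) * Real.exp (N * (s * m + s ^ 2)) := by
        rw [← Finset.mul_sum]
        exact mul_le_mul_of_nonneg_left h2 (Real.exp_pos _).le
    _ = _ := by
        rw [← Real.exp_add]
        congr 1
        ring

/-- If two finite random variables with joint distribution `p` are correlated, then for `N`
independent copies there is a set of pairs of sequences that has almost full probability, while
each of its sections has an exponentially small probability. -/
theorem exists_correlation_sets {X J : Type*} [Fintype X] [Fintype J] (p : X → J → ℝ)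
    (hp : ∀ x j, 0 ≤ p x j) (hp1 : ∑ x, ∑ j, p x j = 1) (x₀ : X) (j₀ : J)
    (hne : p x₀ j₀ ≠ (∑ j, p x₀ j) * ∑ x, p x j₀) :
    ∃ c : ℝ, 0 < c ∧ ∀ N : ℕ, ∃ G : (Fin N → J) → Finset (Fin N → X),
      (∀ y, ∑ x ∈ G y, ∏ n, ∑ j, p (x n) j ≤ Real.exp (-(c * N))) ∧
      1 - Real.exp (-(c * N)) ≤ ∑ y, ∑ x ∈ G y, ∏ n, p (x n) (y n) := by
  classical
  set P : ℝ := ∑ j, p x₀ j with hP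
  set Q : ℝ := ∑ x, p x j₀ with hQ
  set γ : ℝ := p x₀ j₀ - P * Q with hγ
  have hγ0 : γ ≠ 0 := sub_ne_zero.2 hne
  have hP0 : 0 ≤ P := Finset.sum_nonneg fun j _ => hp _ _
  have hQ0 : 0 ≤ Q := Finset.sum_nonneg fun j _ => hp _ _
  have hP1 : P ≤ 1 := hp1 ▸ Finset.single_le_sum (f := fun x => ∑ j, p x j)
    (fun x _ => Finset.sum_nonneg fun j _ => hp _ _) (Finset.mem_univ x₀)
  have hp1' : ∑ j, ∑ x, p x j = 1 := Finset.sum_comm.trans hp1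
  have hQ1 : Q ≤ 1 := hp1' ▸ Finset.single_le_sum (f := fun j => ∑ x, p x j)
    (fun x _ => Finset.sum_nonneg fun j _ => hp _ _) (Finset.mem_univ j₀)
  obtain ⟨σ, hσ1, hσ⟩ : ∃ σ : ℝ, |σ| = 1 ∧ σ * γ = |γ| := by
    rcases lt_or_gt_of_ne hγ0 with h | h
    · exact ⟨-1, by simp, by rw [abs_of_neg h]; ring⟩
    · exact ⟨1, by simp, by rw [abs_of_pos h]; ring⟩
  -- Product of centred indicators, with the sign that makes its mean under `p` equal to `|γ|`,
  -- where `γ` is their covariance. For fixed `j` its mean over the marginal of `x` is 0.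
  let f : X → ℝ := fun x => (if x = x₀ then 1 else 0) - P
  let g : J → ℝ := fun j => (if j = j₀ then 1 else 0) - Q
  let φ : X → J → ℝ := fun x j => σ * (f x * g j)
  have hf : ∀ x, |f x| ≤ 1 := by
    intro x
    simp only [f]
    split_ifs <;> rw [abs_le] <;> constructor <;> linarith
  have hg : ∀ x, |g x| ≤ 1 := by
    intro x
    simp only [g]
    split_ifs <;> rw [abs_le] <;> constructor <;> linarith
  have hφ : ∀ x j, |φ x j| ≤ 1 := by
    intro x j
    simp only [φ, abs_mul, hσ1, one_mul]
    exact mul_le_one₀ (hf x) (abs_nonneg _) (hg j)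
  have hmargin : ∀ j, ∑ x, (∑ j', p x j') * φ x j = 0 := by
    intro j
    have : ∀ x, (∑ j', p x j') * φ x j =
        (σ * g j) * ((∑ j', p x j') * (if x = x₀ then 1 else 0) - (∑ j', p x j') * P) := by
      intro x
      simp only [φ, f]
      ring
    simp only [this, ← Finset.mul_sum, Finset.sum_sub_distrib, ← Finset.sum_mul, hp1]
    simp [hP]
  have hcov : ∑ z : X × J, p z.1 z.2 * φ z.1 z.2 = |γ| := by
    rw [Fintype.sum_prod_type]
    have : ∀ x j, p x j * φ x j = σ * ((if x = x₀ then (if j = j₀ then p x j else 0) else 0)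
        - (if x = x₀ then p x j * Q else 0) - P * (if j = j₀ then p x j else 0)
        + P * Q * p x j) := by
      intro x j
      simp only [φ, f, g]
      split_ifs <;> ring
    simp only [this, ← Finset.mul_sum, Finset.sum_sub_distrib, Finset.sum_add_distrib, hp1]
    simp only [Finset.sum_ite_irrel, Finset.sum_ite_eq', Finset.mem_univ, if_true,
      Finset.sum_const_zero, ← Finset.sum_mul]
    rw [← hP, ← hQ, ← hσ, hγ]
    ring
  have hγ1 : |γ| ≤ 1 := by
    rw [← hcov]
    calc _ ≤ ∑ z : X × J, p z.1 z.2 := Finset.sum_le_sum fun z _ =>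
          mul_le_of_le_one_right (hp _ _) (abs_le.1 (hφ _ _)).2
      _ = 1 := by rw [Fintype.sum_prod_type, hp1]
  have hγpos : 0 < |γ| := abs_pos.2 hγ0
  -- The threshold `|γ| / 2` lies midway between the means 0 and `|γ|`. The exponent is `s ^ 2 - s *
  -- |γ| / 2` for both tails, minimal at `s = |γ| / 4` with value `-|γ| ^ 2 / 16`.
  refine ⟨|γ| ^ 2 / 16, by positivity, fun N => ?_⟩
  refine ⟨fun y => Finset.univ.filter fun x => N * (|γ| / 2) ≤ ∑ n, φ (x n) (y n), fun y => ?_, ?_⟩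
  · refine (sum_filter_prod_le_exp (fun _ x => ∑ j, p x j) (fun n x => φ x (y n))
      (fun _ _ => Finset.sum_nonneg fun j _ => hp _ _) (fun _ => hp1) (fun n x => hφ _ _)
      (s := |γ| / 4) (m := 0) (a := |γ| / 2) (by positivity) (by linarith) (fun n => hmargin _) _
      (fun x hx => (Finset.mem_filter.1 hx).2)).trans (Real.exp_le_exp.2 (le_of_eq ?_))
    ring
  · have hbad := sum_filter_prod_le_exp (N := N) (fun _ (z : X × J) => p z.1 z.2)
      (fun n z => -φ z.1 z.2) (fun _ _ => hp _ _)
      (fun _ => by rw [Fintype.sum_prod_type, hp1]) (fun n z => by rw [abs_neg]; exact hφ _ _)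
      (s := |γ| / 4) (m := -|γ|) (a := -(|γ| / 2)) (by positivity) (by linarith)
      (fun n => by simp only [mul_neg, Finset.sum_neg_distrib, hcov])
      (Finset.univ.filter fun z => ¬ N * (|γ| / 2) ≤ ∑ n, φ (z n).1 (z n).2)
      (fun z hz => by
        have := (Finset.mem_filter.1 hz).2
        simp only [Finset.sum_neg_distrib]
        linarith)
    have htot : ∑ z : Fin N → X × J, ∏ n, p (z n).1 (z n).2 = 1 := by
      have h := Fintype.sum_pow (fun z : X × J => p z.1 z.2) N
      rw [← h, Fintype.sum_prod_type, hp1, one_pow]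
    rw [← Finset.sum_filter_add_sum_filter_not _
      (fun z : Fin N → X × J => N * (|γ| / 2) ≤ ∑ n, φ (z n).1 (z n).2)] at htot
    have hgood : ∑ z ∈ Finset.univ.filter
        (fun z : Fin N → X × J => N * (|γ| / 2) ≤ ∑ n, φ (z n).1 (z n).2),
          ∏ n, p (z n).1 (z n).2 = ∑ y : Fin N → J, ∑ x ∈ Finset.univ.filter
        (fun x : Fin N → X => N * (|γ| / 2) ≤ ∑ n, φ (x n) (y n)), ∏ n, p (x n) (y n) := by
      simp only [Finset.sum_filter]
      rw [← (Equiv.arrowProdEquivProdArrow (Fin N) (fun _ => X) (fun _ => J)).symm.sum_comp,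
        Fintype.sum_prod_type, Finset.sum_comm]
      rfl
    rw [← hgood]
    have : Real.exp (N * (|γ| / 4 * -|γ| + (|γ| / 4) ^ 2 - |γ| / 4 * -(|γ| / 2))) ≤
        Real.exp (-(|γ| ^ 2 / 16 * N)) :=
      Real.exp_le_exp.2 (by nlinarith [sq_nonneg |γ|, Nat.cast_nonneg (α := ℝ) N])
    linarith

namespace OPT

/-! ### Product preparations and product observations -/

section Products

variable {S : Type u} [Category.{v} S] [MonoidalCategory S]

/-- The parallel composition of the preparation events `t (x n)`. -/
def prodState {A : S} {X : Type} (t : X → (𝟙_ S ⟶ A)) :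
    (N : ℕ) → (Fin N → X) → (𝟙_ S ⟶ pow A N)
  | 0, _ => 𝟙 (𝟙_ S)
  -- The head of `x` labels the last tensor factor, so the order is reversed; this is harmless, as
  -- all copies are alike.
  | N + 1, x => (λ_ (𝟙_ S)).inv ≫ (prodState t N (Fin.tail x) ⊗ₘ t (x 0))

/-- The parallel composition of the observation events `a (y n)`. -/
def prodEffect {A : S} {J : Type} (a : J → (A ⟶ 𝟙_ S)) :
    (N : ℕ) → (Fin N → J) → (pow A N ⟶ 𝟙_ S)
  | 0, _ => 𝟙 (𝟙_ S)
  | N + 1, y => (prodEffect a N (Fin.tail y) ⊗ₘ a (y 0)) ≫ (λ_ (𝟙_ S)).hom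

variable (O : OPT S)

/-- Eckmann–Hilton: on endomorphisms of the unit, parallel and sequential composition agree. -/
theorem prob_unitor_tensor (s t : 𝟙_ S ⟶ 𝟙_ S) :
    O.prob ((λ_ (𝟙_ S)).inv ≫ (s ⊗ₘ t) ≫ (λ_ (𝟙_ S)).hom) = O.prob s * O.prob t := by
  rw [← O.prob_comp]
  congr 1
  rw [MonoidalCategory.tensorHom_def, Category.assoc, leftUnitor_naturality, unitors_equal,
    rightUnitor_naturality_assoc, ← unitors_equal, Iso.inv_hom_id_assoc]

theorem IsTest.comp_isDet {O : OPT S} {X : Type} [Finite X] {A B C : S} {f : X → (A ⟶ B)}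
    (hf : O.IsTest f) {T : B ⟶ C} (hT : O.IsDet T) : O.IsTest (fun x => f x ≫ T) :=
  O.relabel _ (Equiv.prodPUnit X).symm (O.seq_test f (fun _ : Unit => T) hf hT)

theorem IsDet.comp_isTest {O : OPT S} {X : Type} [Finite X] {A B C : S} {T : A ⟶ B}
    (hT : O.IsDet T) {f : X → (B ⟶ C)} (hf : O.IsTest f) : O.IsTest (fun x => T ≫ f x) :=
  O.relabel _ (Equiv.punitProd X).symm (O.seq_test (fun _ : Unit => T) f hT hf)

theorem IsDet.comp {O : OPT S} {A B C : S} {T : A ⟶ B} (hT : O.IsDet T) {R : B ⟶ C}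
    (hR : O.IsDet R) : O.IsDet (T ≫ R) :=
  IsTest.comp_isDet (f := fun _ : Unit => T) hT hR

theorem sum_prob_eq_one {O : OPT S} {X J : Type} [Fintype X] [Fintype J] {A : S}
    {t : X → (𝟙_ S ⟶ A)} (ht : O.IsTest t) {a : J → (A ⟶ 𝟙_ S)} (ha : O.IsTest a) :
    ∑ x, ∑ j, O.prob (t x ≫ a j) = 1 := by
  rw [← Fintype.sum_prod_type']
  exact O.prob_sum _ (O.seq_test t a ht ha)

theorem sum_prob_eq_one_of_isDet {O : OPT S} {J : Type} [Fintype J] {A : S}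
    {ρ : 𝟙_ S ⟶ A} (hρ : O.IsDet ρ) {a : J → (A ⟶ 𝟙_ S)} (ha : O.IsTest a) :
    ∑ j, O.prob (ρ ≫ a j) = 1 := by
  simpa using sum_prob_eq_one (t := fun _ : Unit => ρ) hρ ha

theorem sum_prob_le_one {O : OPT S} {J : Type} [Fintype J] {A : S}
    (ρ : 𝟙_ S ⟶ A) {a : J → (A ⟶ 𝟙_ S)} (ha : O.IsTest a) :
    ∑ j, O.prob (ρ ≫ a j) ≤ 1 := by
  obtain ⟨X, _, t, x, ht, rfl⟩ := O.exists_test ρ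
  have := Fintype.ofFinite X
  rw [← sum_prob_eq_one ht ha]
  exact Finset.single_le_sum (f := fun x => ∑ j, O.prob (t x ≫ a j))
    (fun x _ => Finset.sum_nonneg fun j _ => O.prob_nonneg _) (Finset.mem_univ x)

theorem isTest_prodState {O : OPT S} {A : S} {X : Type} [Finite X] {t : X → (𝟙_ S ⟶ A)}
    (ht : O.IsTest t) : ∀ N, O.IsTest (prodState t N)
  | 0 => O.relabel (fun _ : Unit => 𝟙 (𝟙_ S)) (Equiv.ofUnique _ _) (O.id_test _)
  | N + 1 => O.relabel _ ((Fin.consEquiv fun _ => X).symm.trans (Equiv.prodComm _ _))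
      (IsDet.comp_isTest (O.leftUnitor_inv_test (𝟙_ S))
        (O.par_test _ _ (isTest_prodState ht N) ht))

theorem isTest_prodEffect {O : OPT S} {A : S} {J : Type} [Finite J] {a : J → (A ⟶ 𝟙_ S)}
    (ha : O.IsTest a) : ∀ N, O.IsTest (prodEffect a N)
  | 0 => O.relabel (fun _ : Unit => 𝟙 (𝟙_ S)) (Equiv.ofUnique _ _) (O.id_test _)
  | N + 1 => O.relabel _ ((Fin.consEquiv fun _ => J).symm.trans (Equiv.prodComm _ _))
      (IsTest.comp_isDet (O.par_test _ _ (isTest_prodEffect ha N) ha)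
        (O.leftUnitor_hom_test (𝟙_ S)))

theorem prob_id : O.prob (𝟙 (𝟙_ S)) = 1 := by
  simpa using O.prob_sum (fun _ : Unit => 𝟙 (𝟙_ S)) (O.id_test _)

theorem prob_prodState_prodEffect {A : S} {X J : Type} (t : X → (𝟙_ S ⟶ A))
    (a : J → (A ⟶ 𝟙_ S)) : ∀ (N : ℕ) (x : Fin N → X) (y : Fin N → J),
    O.prob (prodState t N x ≫ prodEffect a N y) = ∏ n, O.prob (t (x n) ≫ a (y n))
  | 0, x, y => by
    rw [Finset.univ_eq_empty, Finset.prod_empty]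
    exact (congrArg O.prob (Category.id_comp (𝟙 (𝟙_ S)))).trans O.prob_id
  | N + 1, x, y => by
    rw [Fin.prod_univ_succ, mul_comm]
    have h := prob_prodState_prodEffect t a N (Fin.tail x) (Fin.tail y)
    simp only [Fin.tail] at h
    rw [← h, ← prob_unitor_tensor]
    refine congrArg O.prob ((Category.assoc _ _ _).trans ?_)
    exact congrArg _ (tensorHom_comp_tensorHom_assoc _ _ _ _ _)

/-- The factor `τ` is absorbed into the effect, so the probability depends on `σ` only through its
state. This allows a decomposition of a state to be substituted in one tensor factor. -/
theorem prob_unitor_tensor_comp_left {A B : S} (σ : 𝟙_ S ⟶ A) (τ : 𝟙_ S ⟶ B)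
    (a : A ⊗ B ⟶ 𝟙_ S) :
    O.prob (((λ_ (𝟙_ S)).inv ≫ (σ ⊗ₘ τ)) ≫ a) = (O.state σ).1 ((ρ_ A).inv ≫ (A ◁ τ) ≫ a) := by
  change _ = O.prob _
  congr 1
  rw [MonoidalCategory.tensorHom_def, unitors_inv_equal]
  simp

theorem prob_unitor_tensor_comp_right {A B : S} (σ : 𝟙_ S ⟶ A) (τ : 𝟙_ S ⟶ B)
    (a : A ⊗ B ⟶ 𝟙_ S) :
    O.prob (((λ_ (𝟙_ S)).inv ≫ (σ ⊗ₘ τ)) ≫ a) = (O.state τ).1 ((λ_ B).inv ≫ (σ ▷ B) ≫ a) := by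
  change _ = O.prob _
  congr 1
  rw [MonoidalCategory.tensorHom_def']
  simp

theorem state_sum_apply {A : S} {X : Type} (t : X → (𝟙_ S ⟶ A)) (Y : Finset X)
    (a : A ⟶ 𝟙_ S) : (∑ x ∈ Y, O.state (t x)).1 a = ∑ x ∈ Y, O.prob (t x ≫ a) := by
  rw [Submodule.coe_sum, Finset.sum_apply]
  rfl

theorem prob_eq_sum_of_state_eq_sum {O : OPT S} {A : S} {X : Type} {ρ : 𝟙_ S ⟶ A}
    {t : X → (𝟙_ S ⟶ A)} {Y : Finset X} (h : O.state ρ = ∑ x ∈ Y, O.state (t x))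
    (a : A ⟶ 𝟙_ S) : O.prob (ρ ≫ a) = ∑ x ∈ Y, O.prob (t x ≫ a) := by
  rw [← state_sum_apply, ← h]
  rfl

theorem state_eq_sum_of_prob {O : OPT S} {A : S} {X : Type} {ρ : 𝟙_ S ⟶ A}
    {t : X → (𝟙_ S ⟶ A)} {Y : Finset X}
    (h : ∀ a, O.prob (ρ ≫ a) = ∑ x ∈ Y, O.prob (t x ≫ a)) :
    O.state ρ = ∑ x ∈ Y, O.state (t x) := by
  refine Subtype.ext (funext fun a => ?_)
  rw [state_sum_apply, ← h]
  rfl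

theorem state_statePow_eq_sum {A : S} {X : Type} [Fintype X] {ρ : 𝟙_ S ⟶ A}
    {t : X → (𝟙_ S ⟶ A)} (h : O.state ρ = ∑ x, O.state (t x)) :
    ∀ N, O.state (statePow ρ N) = ∑ x, O.state (prodState t N x)
  | 0 => by simp [statePow, prodState]
  | N + 1 => by
    have ih := state_statePow_eq_sum h N
    refine state_eq_sum_of_prob fun a => ?_
    rw [← ((Fin.consEquiv fun _ => X).symm.trans (Equiv.prodComm _ _)).symm.sum_comp,
      Fintype.sum_prod_type]
    simp only [statePow]
    refine (O.prob_unitor_tensor_comp_left _ _ _).trans ?_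
    rw [ih, state_sum_apply]
    refine Finset.sum_congr rfl fun x _ => ?_
    refine (O.prob_unitor_tensor_comp_left _ ρ _).symm.trans
      ((O.prob_unitor_tensor_comp_right _ ρ _).trans ?_)
    rw [h, state_sum_apply]
    refine Finset.sum_congr rfl fun x' _ => ?_
    exact (O.prob_unitor_tensor_comp_right _ _ _).symm

end Products

variable {S : Type u} [Category.{v} S] [MonoidalCategory S] {O : OPT S}

/-! ### Causality and the operational norm -/

/-- In a strongly causal theory the probability of a preparation does not depend on the observation
test that follows it. -/
theorem StronglyCausal.sum_prob_eq (hO : O.StronglyCausal) {X J : Type} [Finite X] [Fintype J]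
    {A : S} {t : X → (𝟙_ S ⟶ A)} (ht : O.IsTest t) {a b : J → (A ⟶ 𝟙_ S)} (ha : O.IsTest a)
    (hb : O.IsTest b) (x : X) : ∑ j, O.prob (t x ≫ a j) = ∑ j, O.prob (t x ≫ b j) := by
  classical
  have := Fintype.ofFinite X
  have h1 := sum_prob_eq_one ht ha
  -- Compare `a` with the adaptive test that applies `b` after outcome `x` and `a` after every other
  -- outcome: both totals are 1 and differ only in the term of `x`.
  have h2 := O.prob_sum _ (hO t (fun x' => if x' = x then b else a) ht
    (fun x' => by split_ifs <;> assumption))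
  rw [Fintype.sum_prod_type] at h2
  rw [← Finset.add_sum_erase _ _ (Finset.mem_univ x)] at h1 h2
  have h3 : ∑ x' ∈ Finset.univ.erase x, ∑ j, O.prob (t x' ≫ (if x' = x then b else a) j) =
      ∑ x' ∈ Finset.univ.erase x, ∑ j, O.prob (t x' ≫ a j) :=
    Finset.sum_congr rfl fun x' hx' => by rw [if_neg (Finset.ne_of_mem_erase hx')]
  simp only [h3, if_true] at h2
  linarith

/-- `opNorm` is a real `sSup`, so boundedness is needed before any member of the set bounds it from
below. The constant 3 is crude. -/
theorem bddAbove_opNorm_state_sub_state {A : S} (σ τ : 𝟙_ S ⟶ A) :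
    BddAbove {r : ℝ | ∃ (X : Type) (_ : Fintype X) (a : X → (A ⟶ 𝟙_ S)) (j : X), O.IsTest a ∧
      r = 2 * (O.state σ - O.state τ).1 (a j) - ∑ k, (O.state σ - O.state τ).1 (a k)} := by
  refine ⟨3, ?_⟩
  rintro _ ⟨X, _, a, j, ha, rfl⟩
  have e : ∀ k, (O.state σ - O.state τ).1 (a k) = O.prob (σ ≫ a k) - O.prob (τ ≫ a k) :=
    fun k => rfl
  simp only [e, Finset.sum_sub_distrib]
  have h1 := sum_prob_le_one σ ha
  have h2 := sum_prob_le_one τ ha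
  have h3 := Finset.single_le_sum (f := fun k => O.prob (σ ≫ a k))
    (fun k _ => O.prob_nonneg _) (Finset.mem_univ j)
  have h4 := O.prob_nonneg (τ ≫ a j)
  have h5 : 0 ≤ ∑ k, O.prob (σ ≫ a k) := Finset.sum_nonneg fun k _ => O.prob_nonneg _
  linarith

theorem IsTest.exists_coarse_grain {A : S} {X Y : Type} [Fintype X] [DecidableEq Y] [Finite Y]
    {a : X → (A ⟶ 𝟙_ S)} (ha : O.IsTest a) (π : X → Y) (hπ : Function.Surjective π) :
    ∃ s : Y → (A ⟶ 𝟙_ S), O.IsTest s ∧ ∀ (y : Y) (σ : 𝟙_ S ⟶ A),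
      O.prob (σ ≫ s y) = ∑ x with π x = y, O.prob (σ ≫ a x) := by
  obtain ⟨s, hs, h⟩ := O.coarse_grain a π hπ ha
  refine ⟨s, hs, fun y σ => ?_⟩
  simpa using h y (𝟙_ S) (σ ≫ (ρ_ A).inv) (ρ_ (𝟙_ S)).hom

/-- If two preparations have the same total probability for an observation test, then twice
the difference of the probabilities of any set of outcomes is a lower bound of the operational norm
of their difference. -/
theorem two_mul_sum_sub_le_opNorm {A : S} (σ τ : 𝟙_ S ⟶ A) {J : Type} [Fintype J]
    {a : J → (A ⟶ 𝟙_ S)} (ha : O.IsTest a)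
    (h : ∑ j, O.prob (σ ≫ a j) = ∑ j, O.prob (τ ≫ a j)) (Z : Finset J) :
    2 * ∑ j ∈ Z, (O.prob (τ ≫ a j) - O.prob (σ ≫ a j)) ≤ O.opNorm (O.state σ - O.state τ) := by
  classical
  have e : ∀ b, (O.state σ - O.state τ).1 b = O.prob (σ ≫ b) - O.prob (τ ≫ b) :=
    fun k => rfl
  -- Grouping into two outcomes needs a surjection onto `Bool`. If `Z` is empty or everything, the
  -- sum vanishes and only `0 ≤ opNorm` remains to be shown.
  by_cases hZ : (∃ j, j ∈ Z) ∧ ∃ j, j ∉ Z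
  · obtain ⟨⟨j₁, h₁⟩, j₂, h₂⟩ := hZ
    obtain ⟨s, hs, hsum⟩ := ha.exists_coarse_grain (fun j => decide (j ∈ Z)) (by
      rintro (_ | _)
      · exact ⟨j₂, by simpa using h₂⟩
      · exact ⟨j₁, by simpa using h₁⟩)
    -- The outcome `false` is the complement of `Z`: the totals agree, so the excess of `τ` on `Z`
    -- is the excess of `σ` off `Z`.
    refine le_csSup (bddAbove_opNorm_state_sub_state σ τ) ⟨Bool, inferInstance, s, false, hs, ?_⟩
    have hσ := Finset.sum_filter_add_sum_filter_not Finset.univ (· ∈ Z)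
      (fun j => O.prob (σ ≫ a j))
    have hτ := Finset.sum_filter_add_sum_filter_not Finset.univ (· ∈ Z)
      (fun j => O.prob (τ ≫ a j))
    simp only [Finset.filter_univ_mem] at hσ hτ
    simp only [e, hsum, Fintype.sum_bool, decide_eq_true_eq, decide_eq_false_iff_not,
      Finset.filter_univ_mem, Finset.sum_sub_distrib]
    linarith
  · have h0 : ∑ j ∈ Z, (O.prob (τ ≫ a j) - O.prob (σ ≫ a j)) = 0 := by
      rw [not_and_or] at hZ
      rcases hZ with hZ | hZ
      · push Not at hZ
        rw [Finset.eq_empty_of_forall_notMem hZ, Finset.sum_empty]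
      · push Not at hZ
        rw [Finset.eq_univ_of_forall hZ, Finset.sum_sub_distrib, h, sub_self]
    rw [h0, mul_zero]
    obtain ⟨X, _, t, x, ht, -⟩ := O.exists_test σ
    have := Fintype.ofFinite X
    have hne : (Finset.univ : Finset J).Nonempty := by
      by_contra hne
      have h1 := sum_prob_eq_one ht ha
      rw [Finset.not_nonempty_iff_eq_empty] at hne
      simp [hne] at h1
    obtain ⟨j, -, hj⟩ := Finset.exists_le_of_sum_le hne h.ge
    refine le_csSup_of_le (bddAbove_opNorm_state_sub_state σ τ) ⟨J, inferInstance, a, j, ha, rfl⟩ ?_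
    simp only [e, Finset.sum_sub_distrib, h, sub_self, sub_zero]
    linarith

/-! ### Guessing through a small system -/

/-- A message guessed from the states of a system is guessed correctly with a probability at most
the size of the system times the largest prior probability of the set of guesses. -/
theorem sum_sum_prob_le_size_mul {B : S} [FiniteDimensional ℝ (O.StR B)] {X J : Type} [Fintype X]
    [Fintype J] (σ : X → (𝟙_ S ⟶ B)) (b : J → (B ⟶ 𝟙_ S)) (G : J → Finset X) {κ : ℝ}
    (hκ0 : 0 ≤ κ) (hκ : ∀ j, ∑ x ∈ G j, ∑ j', O.prob (σ x ≫ b j') ≤ κ) :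
    ∑ j, ∑ x ∈ G j, O.prob (σ x ≫ b j) ≤ O.size B * κ := by
  set p : X → ℝ := fun x => ∑ j, O.prob (σ x ≫ b j) with hp
  have hp0 : ∀ x, 0 ≤ p x := fun x => Finset.sum_nonneg fun j _ => O.prob_nonneg _
  -- The states are normalized by their prior probabilities; where the prior is 0 the inverse is 0
  -- by convention, and all the outcome probabilities vanish too.
  obtain ⟨r, s, hr, hs⟩ := exists_subfamily_abs_coeff_le_one (fun x => (p x)⁻¹ • O.state (σ x))
  choose c hc hw using hs
  let β : X → J → ℝ := fun x j => (p x)⁻¹ * O.prob (σ x ≫ b j)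
  have hβ0 : ∀ x j, 0 ≤ β x j := fun x j => mul_nonneg (inv_nonneg.2 (hp0 x)) (O.prob_nonneg _)
  have hβ1 : ∀ x, ∑ j, β x j ≤ 1 := by
    intro x
    rw [← Finset.mul_sum]
    exact inv_mul_le_one
  have hβ : ∀ x j, O.prob (σ x ≫ b j) = p x * β x j := by
    intro x j
    rcases eq_or_ne (p x) 0 with h | h
    · rw [h, zero_mul]
      exact (Finset.sum_eq_zero_iff_of_nonneg fun j _ => O.prob_nonneg _).1 h j (Finset.mem_univ j)
    · rw [mul_inv_cancel_left₀ h]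
  -- The conditional probabilities have a majorant independent of `x`, whose total over `j` is at
  -- most `r ≤ O.size B`. This is where the dimension enters.
  have hexp : ∀ x j, β x j ≤ ∑ i, β (s i) j := by
    intro x j
    have h := congrFun (congrArg Subtype.val (hw x)) (b j)
    rw [Submodule.coe_sum, Finset.sum_apply] at h
    refine (show β x j = ∑ i, c x i * β (s i) j from h).trans_le
      (Finset.sum_le_sum fun i _ => ?_)
    exact mul_le_of_le_one_left (hβ0 _ _) (abs_le.1 (hc x i)).2
  calc ∑ j, ∑ x ∈ G j, O.prob (σ x ≫ b j)
      ≤ ∑ j, ∑ x ∈ G j, p x * ∑ i, β (s i) j := by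
        refine Finset.sum_le_sum fun j _ => Finset.sum_le_sum fun x _ => ?_
        rw [hβ]
        exact mul_le_mul_of_nonneg_left (hexp x j) (hp0 x)
    _ ≤ ∑ j, κ * ∑ i, β (s i) j := by
        refine Finset.sum_le_sum fun j _ => ?_
        rw [← Finset.sum_mul]
        exact mul_le_mul_of_nonneg_right (hκ j) (Finset.sum_nonneg fun i _ => hβ0 _ _)
    _ = κ * ∑ i, ∑ j, β (s i) j := by rw [← Finset.mul_sum, Finset.sum_comm]
    _ ≤ κ * ∑ _i : Fin r, 1 :=
        mul_le_mul_of_nonneg_left (Finset.sum_le_sum fun i _ => hβ1 _) hκ0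
    _ ≤ O.size B * κ := by
        rw [mul_comm]
        refine mul_le_mul_of_nonneg_right ?_ hκ0
        simpa using (by exact_mod_cast hr : (r : ℝ) ≤ O.size B)

theorem isDilation_comp_rightUnitor_inv {A : S} (ρ : 𝟙_ S ⟶ A) :
    O.IsDilation ρ (ρ ≫ (ρ_ A).inv) :=
  ⟨𝟙 _, O.id_test _, by simp⟩

/-- A state is a dilation of itself with the trivial ancilla, so the disturbance controls plain
refinements; no larger ancilla is needed. -/
theorem sum_opNorm_lt_of_disturbance_lt {A : S} {ρ : 𝟙_ S ⟶ A} {T : A ⟶ A} {ε : ℝ}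
    (hT : O.disturbance ρ T < (ε : EReal)) {X : Type} [Fintype X] {t : X → (𝟙_ S ⟶ A)}
    (ht : O.IsTest t) (hρ : O.state ρ = ∑ x, O.state (t x)) :
    ∑ x, O.opNorm (O.state ((t x ≫ (ρ_ A).inv) ≫ (T ▷ 𝟙_ S)) - O.state (t x ≫ (ρ_ A).inv))
      < ε := by
  rw [← EReal.coe_lt_coe_iff]
  refine lt_of_le_of_lt (le_sSup ?_) hT
  refine ⟨𝟙_ S, _, X, inferInstance, fun x => t x ≫ (ρ_ A).inv, Finset.univ,
    isDilation_comp_rightUnitor_inv ρ, ⟨ht.comp_isDet (O.rightUnitor_inv_test A), ?_⟩, rfl⟩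
  refine state_eq_sum_of_prob fun a => ?_
  simp only [Category.assoc]
  exact prob_eq_sum_of_state_eq_sum hρ _

/-- A transformation that factors through `B` and disturbs a refinement `t` little can preserve the
correlation between `t` and an observation test only if `B` is large. -/
theorem StronglyCausal.sum_sum_prob_le_of_disturbance_lt (hO : O.StronglyCausal) {A B : S}
    [FiniteDimensional ℝ (O.StR B)] {ρ : 𝟙_ S ⟶ A} {E : A ⟶ B} {D : B ⟶ A} (hE : O.IsDet E)
    (hD : O.IsDet D) {ε : ℝ} (hT : O.disturbance ρ (E ≫ D) < (ε : EReal))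
    {X J : Type} [Fintype X] [Fintype J] {t : X → (𝟙_ S ⟶ A)}
    (ht : O.IsTest t) (hρ : O.state ρ = ∑ x, O.state (t x)) {a : J → (A ⟶ 𝟙_ S)}
    (ha : O.IsTest a) (G : J → Finset X) {κ : ℝ} (hκ0 : 0 ≤ κ)
    (hκ : ∀ j, ∑ x ∈ G j, ∑ j', O.prob (t x ≫ a j') ≤ κ) :
    ∑ j, ∑ x ∈ G j, O.prob (t x ≫ a j) ≤ O.size B * κ + ε / 2 := by
  classical
  have hTa : O.IsTest (fun j => (E ≫ D) ≫ a j) := (hE.comp hD).comp_isTest ha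
  -- By strong causality, inserting `E ≫ D` before the observation leaves the prior of each `x`
  -- unchanged, so `κ` also bounds the guesses made from `B`.
  have hmargin := fun x => hO.sum_prob_eq ht hTa ha x
  have h1 := sum_sum_prob_le_size_mul (O := O) (fun x => t x ≫ E) (fun j => D ≫ a j) G hκ0 (fun j => by
    simp only [Category.assoc] at hmargin ⊢
    simp only [hmargin]
    exact hκ j)
  have ha' : O.IsTest (fun j => (ρ_ A).hom ≫ a j) :=
    IsDet.comp_isTest (O.rightUnitor_hom_test A) ha
  have e1 : ∀ x j, O.prob (((t x ≫ (ρ_ A).inv) ≫ ((E ≫ D) ▷ 𝟙_ S)) ≫ (ρ_ A).hom ≫ a j) =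
      O.prob (t x ≫ (E ≫ D) ≫ a j) := by
    intro x j
    congr 1
    simp
  have e2 : ∀ x j, O.prob ((t x ≫ (ρ_ A).inv) ≫ (ρ_ A).hom ≫ a j) = O.prob (t x ≫ a j) := by
    intro x j
    simp
  -- For each `x` the successful outcomes are those `j` with `x ∈ G j`; summing the norm bounds
  -- limits the total loss of success to `ε / 2`.
  have h2 : ∑ x, 2 * ∑ j with x ∈ G j, (O.prob (t x ≫ a j) - O.prob (t x ≫ (E ≫ D) ≫ a j)) ≤ ε := by
    refine (Finset.sum_le_sum fun x _ => ?_).trans (sum_opNorm_lt_of_disturbance_lt hT ht hρ).le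
    have h := two_mul_sum_sub_le_opNorm ((t x ≫ (ρ_ A).inv) ≫ ((E ≫ D) ▷ 𝟙_ S))
      (t x ≫ (ρ_ A).inv) ha' (by simp only [e1, e2, hmargin]) (Finset.univ.filter fun j => x ∈ G j)
    simpa only [e1, e2] using h
  have hswap : ∀ f : X → J → ℝ, ∑ x, ∑ j with x ∈ G j, f x j = ∑ j, ∑ x ∈ G j, f x j := by
    intro f
    exact Finset.sum_comm' (by simp)
  rw [← Finset.mul_sum, hswap] at h2
  simp only [Finset.sum_sub_distrib, Category.assoc] at h1 h2
  linarith

/-! ### Vanishing information content forces independence -/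

/-- If the information content vanishes, then reliable compression to a system of subexponential
size is possible. -/
theorem eventually_exists_reliableScheme_of_infoContent_eq_zero {B A : S} {ρ : 𝟙_ S ⟶ A}
    (hI : O.infoContent B ρ = 0) {δ : ℝ} (hδ : 0 < δ) :
    ∀ᶠ N : ℕ in atTop, ∃ M : ℕ, (M : ℝ) ≤ δ * N ∧ (O.reliableSchemes B ρ N M 1).Nonempty := by
  have h := O.tendsto_infoContent B ρ
  rw [hI] at h
  have h1 := h.eventually_lt_const (ENNReal.ofReal_pos.2 hδ)
  have h2 : ∀ᶠ ε : ℝ in 𝓝[>] 0, ε < 1 :=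
    nhdsWithin_le_nhds (eventually_lt_nhds zero_lt_one)
  obtain ⟨ε, hε, hε1⟩ := (h1.and h2).exists
  filter_upwards [eventually_lt_of_limsup_lt hε, eventually_gt_atTop 0] with N hN hN0
  obtain ⟨_, ⟨M, ⟨c, hc1, hc2, hc3⟩, rfl⟩, hM⟩ := sInf_lt_iff.1 hN
  refine ⟨M, ?_, c, hc1, hc2, hc3.trans (by exact_mod_cast hε1)⟩
  rw [ENNReal.div_lt_iff (Or.inl (by exact_mod_cast hN0.ne')) (Or.inl (ENNReal.natCast_ne_top N)),
    ← ENNReal.ofReal_natCast, ← ENNReal.ofReal_natCast, ← ENNReal.ofReal_mul hδ.le,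
    ENNReal.ofReal_lt_ofReal_iff (by positivity)] at hM
  exact hM.le

/-- Every observation event belongs to a test, whose outcomes add up to a deterministic effect. -/
theorem exists_isDet_prob_eq_sum (O : OPT S) {A : S} (b : A ⟶ 𝟙_ S) :
    ∃ e : A ⟶ 𝟙_ S, O.IsDet e ∧ ∃ (J : Type) (_ : Fintype J) (a : J → (A ⟶ 𝟙_ S)) (j : J),
      O.IsTest a ∧ a j = b ∧ ∀ σ : 𝟙_ S ⟶ A, O.prob (σ ≫ e) = ∑ j, O.prob (σ ≫ a j) := by
  obtain ⟨J, _, a, j, ha, hj⟩ := O.exists_test b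
  have := Fintype.ofFinite J
  obtain ⟨s, hs, h⟩ := ha.exists_coarse_grain (fun _ => ()) (fun _ => ⟨j, rfl⟩)
  exact ⟨s (), hs, J, this, a, j, ha, hj, fun σ => by simpa using h () σ⟩

/-- The events of a refinement of a deterministic state have total probability one, so the other
events of the preparation test never happen. -/
theorem state_eq_sum_univ_of_isRefinement {A : S} {ρ : 𝟙_ S ⟶ A} (hρ : O.IsDet ρ) {X : Type}
    [Fintype X] {t : X → (𝟙_ S ⟶ A)} {Y : Finset X} (h : O.IsRefinement ρ t Y) :
    O.state ρ = ∑ x, O.state (t x) := by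
  classical
  rw [h.2]
  refine Finset.sum_subset (Finset.subset_univ Y) fun x _ hx => Subtype.ext (funext fun b => ?_)
  change O.prob (t x ≫ b) = 0
  obtain ⟨J, _, a, j, ha, rfl⟩ := O.exists_test b
  have := Fintype.ofFinite J
  have h1 := sum_prob_eq_one h.1 ha
  have h2 := sum_prob_eq_one_of_isDet hρ ha
  simp only [prob_eq_sum_of_state_eq_sum h.2] at h2
  rw [Finset.sum_comm] at h2
  rw [← Finset.sum_add_sum_compl Y, h2, add_eq_left] at h1
  have h3 := (Finset.sum_eq_zero_iff_of_nonneg fun x _ =>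
    Finset.sum_nonneg fun j _ => O.prob_nonneg _).1 h1 x (Finset.mem_compl.2 hx)
  exact (Finset.sum_eq_zero_iff_of_nonneg fun j _ => O.prob_nonneg _).1 h3 j (Finset.mem_univ j)

/-- In a strongly causal theory with regular scaling, no observation test is correlated with a
refinement of a state of vanishing information content. -/
theorem StronglyCausal.prob_eq_mul_of_infoContent_eq_zero (hO : O.StronglyCausal)
    (hfin : O.IsFiniteDim) (hscal : O.RegularScaling) {B A : S} {ρ : 𝟙_ S ⟶ A}
    (hI : O.infoContent B ρ = 0) {X J : Type} [Fintype X] [Fintype J]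
    {t : X → (𝟙_ S ⟶ A)} (ht : O.IsTest t) (hρ : O.state ρ = ∑ x, O.state (t x))
    {a : J → (A ⟶ 𝟙_ S)} (ha : O.IsTest a) (x : X) (j : J) :
    O.prob (t x ≫ a j) = (∑ j', O.prob (t x ≫ a j')) * O.prob (ρ ≫ a j) := by
  by_contra hne
  rw [prob_eq_sum_of_state_eq_sum hρ] at hne
  obtain ⟨c, hc, hG⟩ := exists_correlation_sets (fun x j => O.prob (t x ≫ a j))
    (fun _ _ => O.prob_nonneg _) (sum_prob_eq_one ht ha) x j hne
  obtain ⟨k, hk, hsize⟩ := hscal B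
  -- The maximum with 1 covers size 0 and keeps the logarithm nonnegative.
  set L := Real.log (max (O.size B) 1) with hL
  have hL0 : 0 ≤ L := Real.log_nonneg (le_max_right _ _)
  have hexp : (O.size B : ℝ) ≤ Real.exp L := by
    rw [hL, Real.exp_log (lt_max_of_lt_right one_pos)]
    exact le_max_left _ _
  -- At this rate `B` to the power `M` has size at most `k * exp (c / 2 * N)`, which uses up half of
  -- the exponent `c`. The `+ 1` avoids division by zero.
  have hδ : 0 < c / (2 * (L + 1)) := by positivity
  have hlim : Tendsto (fun N : ℕ => (1 + k) * Real.exp (-(c / 2 * N))) atTop (𝓝 0) := by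
    have h : Tendsto (fun N : ℕ => c / 2 * (N : ℝ)) atTop atTop :=
      tendsto_natCast_atTop_atTop.const_mul_atTop (by positivity)
    simpa using (Real.tendsto_exp_neg_atTop_nhds_zero.comp h).const_mul (1 + k)
  obtain ⟨N, ⟨M, hM, s, hs1, hs2, hs3⟩, hN⟩ :=
    ((eventually_exists_reliableScheme_of_infoContent_eq_zero hI hδ).and
      (hlim.eventually_lt_const (show (0 : ℝ) < 1 / 2 by norm_num))).exists
  obtain ⟨G, hG1, hG2⟩ := hG N
  have := hfin (pow B M)
  have hmain := hO.sum_sum_prob_le_of_disturbance_lt hs1 hs2 hs3 (isTest_prodState ht N)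
    (O.state_statePow_eq_sum hρ N) (isTest_prodEffect ha N) G (Real.exp_pos (-(c * N))).le
    (fun y => by
      classical
      simp only [prob_prodState_prodEffect]
      refine le_of_eq_of_le (Finset.sum_congr rfl fun x _ => ?_) (hG1 y)
      rw [Finset.prod_univ_sum _ fun n j => O.prob (t (x n) ≫ a j), Fintype.piFinset_univ])
  simp only [prob_prodState_prodEffect] at hmain
  have hD : (O.size (pow B M) : ℝ) ≤ k * Real.exp (c / 2 * N) := by
    refine (hsize M).trans (mul_le_mul_of_nonneg_left ?_ hk.le)
    refine (pow_le_pow_left₀ (Nat.cast_nonneg _) hexp M).trans ?_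
    rw [← Real.exp_nat_mul]
    refine Real.exp_le_exp.2 ?_
    calc (M : ℝ) * L ≤ (c / (2 * (L + 1)) * N) * (L + 1) :=
          mul_le_mul hM (by linarith) hL0 (by positivity)
      _ = c / 2 * N := by field_simp
  have hD' : (O.size (pow B M) : ℝ) * Real.exp (-(c * N)) ≤ k * Real.exp (-(c / 2 * N)) := by
    refine (mul_le_mul_of_nonneg_right hD (Real.exp_pos _).le).trans (le_of_eq ?_)
    rw [mul_assoc, ← Real.exp_add]
    ring_nf
  have hsmall : Real.exp (-(c * N)) ≤ Real.exp (-(c / 2 * N)) :=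
    Real.exp_le_exp.2 (by nlinarith [Nat.cast_nonneg (α := ℝ) N])
  linarith

end OPT

theorem mainTheorem3 {S : Type u} [Category.{v} S] [MonoidalCategory S] (O : OPT S)
    (hfin : O.IsFiniteDim) (hcausal : O.StronglyCausal) (hdig : O.Digitalizable)
    (hscal : O.RegularScaling) (B : S) (hB : O.IsObit B) {A : S} (ρ : 𝟙_ S ⟶ A)
    (hρ : O.IsDet ρ) (hI : O.infoContent B ρ = 0) : O.IsPure ρ := by
  intro X _ t Y href i _
  have hsum := OPT.state_eq_sum_univ_of_isRefinement hρ href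
  -- Without effects on `A` all its states coincide, and any coefficient will do.
  rcases isEmpty_or_nonempty (A ⟶ 𝟙_ S) with hA | ⟨⟨b₀⟩⟩
  · exact ⟨0, le_rfl, zero_le_one, Subtype.ext (funext fun b => hA.elim b)⟩
  obtain ⟨e, he, -⟩ := O.exists_isDet_prob_eq_sum b₀
  refine ⟨O.prob (t i ≫ e), O.prob_nonneg _, ?_, Subtype.ext (funext fun b => ?_)⟩
  · simpa using OPT.sum_prob_le_one (t i) (a := fun _ : Unit => e) he
  · change O.prob (t i ≫ b) = O.prob (t i ≫ e) * O.prob (ρ ≫ b)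
    -- The test containing `b` sums to its own deterministic effect `e'`. Causality equates the
    -- probabilities of `t i` under `e` and `e'`, so one coefficient serves every `b`.
    obtain ⟨e', he', J, _, a, j, ha, rfl, hsum'⟩ := O.exists_isDet_prob_eq_sum b
    have h := hcausal.sum_prob_eq href.1 (a := fun _ : Unit => e) (b := fun _ => e') he he' i
    simp only [Finset.univ_unique, Finset.sum_singleton] at h
    rw [h, hsum']
    exact hcausal.prob_eq_mul_of_infoContent_eq_zero hfin hscal hI href.1 hsum ha i j
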